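/- A stable matching instance (with complete preference lists) of size $n \ge 1$ consists of $n$ men and $n$ women, each of whom ranks all $n$ agents of the opposite sex in a strict linear order; write $P_a(b) \in \{1,\dots,n\}$ for the rank of $b$ in the list of $a$. A matching is a bijection $\mu$ between the men and the women; it is stable if no man and woman prefer each other to their partners in $\mu$. For an agent $a$ let $\mathrm{minrank}(a)$ and $\mathrm{maxrank}(a)$ be the smallest and the largest rank of $a$ in the lists of the agents of the opposite sex. The range of an instance $I$ is $\mathrm{range}(I) = \max_{a} (\mathrm{maxrank}(a) - \mathrm{minrank}(a)) + 1$, the maximum being over all men and women, and $\mathrm{range}(c)$ also denotes the class of all instances $I$ of any size $n \ge 1$ with $\mathrm{range}(I) \le c$. A rotation exposed in a stable matching $\mu$ is a nonempty circular list $\rho = (m_1,w_1),\dots,(m_\ell,w_\ell)$ of distinct pairs of $\mu$ such that, for every $i$ (indices modulo $\ell$), $w_{i+1}$ is the first woman after $w_i$ on the list of $m_i$ who prefers $m_i$ to her partner in $\mu$. Eliminating $\rho$ from $\mu$ gives the stable matching in which each $m_i$ is matched to $w_{i+1}$ and all other men keep their partners. Every stable matching $\mu$ is obtained from the man-optimal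 stable matching by successively eliminating exposed rotations, and the set $R_\mu$ of the rotations eliminated on the way depends only on $\mu$. The rotation poset of $I$ is the set of all rotations exposed in some stable matching of $I$, with $\rho \prec \rho'$ if and only if $\rho \in R_\mu$ for every stable matching $\mu$ in which $\rho'$ is exposed. The instance $I$ realizes a finite poset $\mathcal P$ if its rotation poset is isomorphic to $\mathcal P$. Statement: there is no constant $c$ such that every finite poset is realized by some instance in $\mathrm{range}(c)$. -/

import Mathlib

/-- A stable matching instance of size `n` with complete preference lists, with men `M` and
women `W`: every agent ranks all `n` agents of the opposite sex by a bijection onto `Fin n`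
(a smaller rank is better; positions are counted from `0`). -/
structure SMInstance (M W : Type) (n : ℕ) where
  /-- `manRank m w` is the position of the woman `w` in the list of the man `m`. -/
  manRank : M → (W ≃ Fin n)
  /-- `womanRank w m` is the position of the man `m` in the list of the woman `w`. -/
  womanRank : W → (M ≃ Fin n)

namespace SMInstance

/-- `m` prefers `w` to `w'`. -/
def ManPrefers {M W : Type} {n : ℕ} (I : SMInstance M W n) (m : M) (w w' : W) : Prop :=
  I.manRank m w < I.manRank m w'

/-- `w` prefers `m` to `m'`. -/
def WomanPrefers {M W : Type} {n : ℕ} (I : SMInstance M W n) (w : W) (m m' : M) : Prop :=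
  I.womanRank w m < I.womanRank w m'

/-- A matching `μ : M ≃ W` is stable if there is no blocking pair, that is, no man `m` and
woman `w` who prefer each other to their partners in `μ`. -/
def IsStable {M W : Type} {n : ℕ} (I : SMInstance M W n) (μ : M ≃ W) : Prop :=
  ¬ ∃ (m : M) (w : W), I.ManPrefers m w (μ m) ∧ I.WomanPrefers w m (μ.symm w)

/-- The man-optimal stable matching: every man gets his best stable partner. -/
def IsManOptimal {M W : Type} {n : ℕ} (I : SMInstance M W n) (μ : M ≃ W) : Prop :=
  I.IsStable μ ∧ ∀ ν : M ≃ W, I.IsStable ν → ∀ m : M, I.manRank m (μ m) ≤ I.manRank m (ν m)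

/-- A circular list `ρ = (m₁, w₁), …, (mₗ, wₗ)` of distinct pairs of the stable matching `μ` is a
rotation exposed in `μ` if, for every `i` (cyclically), `wᵢ₊₁` is the first woman after `wᵢ` on
the list of `mᵢ` who prefers `mᵢ` to her partner in `μ` (this partner is `mᵢ₊₁`). -/
def IsExposed {M W : Type} {n : ℕ} (I : SMInstance M W n) (ρ : Cycle (M × W)) (μ : M ≃ W) :
    Prop :=
  I.IsStable μ ∧ ρ ≠ Cycle.nil ∧ ρ.Nodup ∧ (∀ p ∈ ρ, μ p.1 = p.2) ∧
    ρ.Chain fun p q : M × W =>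
      I.ManPrefers p.1 p.2 q.2 ∧ I.WomanPrefers q.2 p.1 q.1 ∧
        ∀ w : W, I.ManPrefers p.1 p.2 w → I.ManPrefers p.1 w q.2 →
          ¬ I.WomanPrefers w p.1 (μ.symm w)

/-- `μ'` is the elimination of `ρ` from `μ`: it matches each `mᵢ` of `ρ` to `wᵢ₊₁` and agrees
with `μ` on all men who are not in `ρ`. -/
def IsElimination {M W : Type} (μ : M ≃ W) (ρ : Cycle (M × W)) (μ' : M ≃ W) : Prop :=
  (ρ.Chain fun p q : M × W => μ' p.1 = q.2) ∧ ∀ m : M, (∀ w : W, (m, w) ∉ ρ) → μ' m = μ m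

/-- `I.Reaches μ S`: some sequence of successive eliminations of exposed rotations leads from the
man-optimal stable matching to `μ`, and `S` is the set of the rotations in that sequence. -/
inductive Reaches {M W : Type} {n : ℕ} (I : SMInstance M W n) :
    (M ≃ W) → Set (Cycle (M × W)) → Prop
  | manOptimal (μ : M ≃ W) (h : I.IsManOptimal μ) : Reaches I μ ∅
  | eliminate (μ μ' : M ≃ W) (S : Set (Cycle (M × W))) (ρ : Cycle (M × W))
      (h : Reaches I μ S) (hρ : I.IsExposed ρ μ) (hμ' : IsElimination μ ρ μ') :
      Reaches I μ' (insert ρ S)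

/-- The set `R_μ` of the rotations that are eliminated on the way from the man-optimal stable
matching to `μ`. (By a theorem of Irving and Leather all elimination sequences that lead to `μ`
consist of the same rotations, so the union over all sequences taken here is the set of rotations
of any one of them.) -/
def eliminated {M W : Type} {n : ℕ} (I : SMInstance M W n) (μ : M ≃ W) :
    Set (Cycle (M × W)) :=
  {ρ | ∃ S, I.Reaches μ S ∧ ρ ∈ S}

/-- The type `R(I)` of all rotations of `I`: those exposed in some stable matching. -/
def Rotation {M W : Type} {n : ℕ} (I : SMInstance M W n) : Type :=
  {ρ : Cycle (M × W) // ∃ μ : M ≃ W, I.IsExposed ρ μ}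

/-- The strict order of the rotation poset: `ρ` precedes `ρ'` if `ρ` has been eliminated in every
stable matching in which `ρ'` is exposed. -/
def Precedes {M W : Type} {n : ℕ} (I : SMInstance M W n) (ρ ρ' : I.Rotation) : Prop :=
  ∀ μ : M ≃ W, I.IsExposed ρ'.1 μ → ρ.1 ∈ I.eliminated μ

/-- `I` realizes the poset `P` if its rotation poset is isomorphic to `P`. -/
def Realizes {M W : Type} {n : ℕ} (I : SMInstance M W n) (P : Type) [PartialOrder P] : Prop :=
  ∃ f : P ≃ I.Rotation, ∀ x y : P, x < y ↔ I.Precedes (f x) (f y)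

/-- The smallest position at which the woman `w` appears in the men's lists. -/
noncomputable def womanMinRank {M W : Type} {n : ℕ} (I : SMInstance M W n) (w : W) : ℕ :=
  ⨅ m : M, (I.manRank m w : ℕ)

/-- The largest position at which the woman `w` appears in the men's lists. -/
noncomputable def womanMaxRank {M W : Type} {n : ℕ} (I : SMInstance M W n) (w : W) : ℕ :=
  ⨆ m : M, (I.manRank m w : ℕ)

/-- The smallest position at which the man `m` appears in the women's lists. -/
noncomputable def manMinRank {M W : Type} {n : ℕ} (I : SMInstance M W n) (m : M) : ℕ :=
  ⨅ w : W, (I.womanRank w m : ℕ)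

/-- The largest position at which the man `m` appears in the women's lists. -/
noncomputable def manMaxRank {M W : Type} {n : ℕ} (I : SMInstance M W n) (m : M) : ℕ :=
  ⨆ w : W, (I.womanRank w m : ℕ)

/-- The range of `I`: the maximum over all agents of (maxrank - minrank), plus one. -/
noncomputable def range {M W : Type} {n : ℕ} (I : SMInstance M W n) : ℕ :=
  max (⨆ w : W, (I.womanMaxRank w - I.womanMinRank w))
    (⨆ m : M, (I.manMaxRank m - I.manMinRank m)) + 1

end SMInstance

/-! The obstruction is the complete bipartite poset: `N` minimal elements, all below `N` maximal
ones. In a realization, the minimal rotations `ρ i` are all exposed in the man-optimal matching `μ`,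
and the maximal ones `σ j` are all exposed in the matching `κ` obtained from `μ` by eliminating
every `ρ i` (`Realizes.exists_rotations`). Moreover `κ` is the man-best matching exposing `σ j`.
Hence some step of `σ j` starts at or skips a woman of `ρ i`: otherwise `σ j` would still be exposed
after undoing `ρ i` (`exists_woman_between`).

When the range is at most `c`, the list of a single man `m₀` serves as a common ruler. A pigeonhole
count shows that a man's next woman is at most `8 * c + 2` places after his partner on it
(`IsNext.position_le`). So each rotation occupies a set of positions without long gaps, the sets of
the `ρ i` are pairwise disjoint, so are those of the `σ j`, and every `ρ i` comes close to every `σ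
j`.

Such families are small (`card_le_of_pairwise_close`). At the leftmost right end of all the sets,
every set of the other family has an element in one short window, and disjointness bounds their
number linearly in `c`. -/

/-! ### Cycles -/

namespace Cycle

variable {α : Type*} {r : α → α → Prop} {s t : Cycle α}

theorem exists_eq_cons_of_mem {a : α} (h : a ∈ s) : ∃ l : List α, s = (↑(a :: l) : Cycle α) := by
  induction s using Quotient.inductionOn' with
  | h l =>
    obtain ⟨l₁, l₂, rfl⟩ := List.append_of_mem (Cycle.mem_coe_iff.1 h)
    exact ⟨l₂ ++ l₁, Cycle.coe_eq_coe.2 (by simpa using List.isRotated_append (l := l₁) (l' := a :: l₂))⟩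

theorem Chain.and_mem (h : s.Chain r) : s.Chain fun x y => x ∈ s ∧ y ∈ s ∧ r x y := by
  induction s using Cycle.induction_on with
  | nil => trivial
  | cons a l _ =>
    rw [Cycle.chain_coe_cons] at h ⊢
    refine (List.IsChain.iff_mem.1 h).imp fun x y hxy => ?_
    simpa [Cycle.mem_coe_iff, or_comm, or_assoc, or_left_comm] using hxy

theorem Chain.and {r' : α → α → Prop} (h : s.Chain r) (h' : s.Chain r') :
    s.Chain fun x y => r x y ∧ r' x y := by
  induction s using Cycle.induction_on with
  | nil => trivial
  | cons a l _ =>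
    rw [Cycle.chain_coe_cons] at h h' ⊢
    rw [List.isChain_iff_forall_rel_of_append_cons_cons] at h h' ⊢
    exact fun a b l₁ l₂ e => ⟨h e, h' e⟩

theorem Chain.exists_next (h : s.Chain r) {a : α} (ha : a ∈ s) : ∃ b ∈ s, r a b := by
  obtain ⟨l, rfl⟩ := exists_eq_cons_of_mem ha
  have h' := h.and_mem
  rw [Cycle.chain_coe_cons] at h'
  cases l with
  | nil =>
    rw [List.nil_append, List.isChain_cons_cons] at h'
    exact ⟨_, h'.1.2⟩
  | cons b l =>
    rw [List.cons_append, List.isChain_cons_cons] at h'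
    exact ⟨_, h'.1.2⟩

/-- A property that is passed on along a cyclic chain and holds somewhere holds everywhere. -/
theorem Chain.forall_of_imp (h : s.Chain r) {Q : α → Prop} (hQ : ∀ x y, r x y → Q x → Q y)
    {a b : α} (ha : a ∈ s) (hb : b ∈ s) (hqa : Q a) : Q b := by
  have : IsTrans α fun x y => Q x → Q y := ⟨fun _ _ _ h₁ h₂ h₃ => h₂ (h₁ h₃)⟩
  exact Cycle.chain_iff_pairwise.1 (h.imp hQ) a ha b hb hqa

/-- If nothing preceded `a`, the property of being different from `a` would propagate around the
cycle from a successor of `a` back to `a`. -/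
theorem Chain.exists_prev (h : s.Chain r) {a : α} (ha : a ∈ s) : ∃ b ∈ s, r b a := by
  by_contra! hno
  obtain ⟨b, hb, hab⟩ := h.exists_next ha
  refine h.and_mem.forall_of_imp (Q := fun x => x ≠ a) ?_ hb ha ?_ rfl
  · rintro x y ⟨hx, -, hxy⟩ - rfl
    exact hno x hx hxy
  · rintro rfl
    exact hno b hb hab

/-- A functional relation forces both walks from `b` to run in step, and each ends at its first
visit to `a`. -/
theorem _root_.List.eq_of_isChain_of_rightUnique (hr : Relator.RightUnique r) {a : α} :
    ∀ {b : α} {l l' : List α}, a ∉ l → a ∉ l' → (b :: (l ++ [a])).IsChain r →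
      (b :: (l' ++ [a])).IsChain r → l = l'
  | _, [], [], _, _, _, _ => rfl
  | _, [], y :: l', _, h', h₁, h₂ => by
    simp only [List.nil_append, List.cons_append, List.isChain_cons_cons] at h₁ h₂
    exact absurd (hr h₁.1 h₂.1) (by simp at h'; exact h'.1)
  | _, x :: l, [], h, _, h₁, h₂ => by
    simp only [List.nil_append, List.cons_append, List.isChain_cons_cons] at h₁ h₂
    exact absurd (hr h₂.1 h₁.1) (by simp at h; exact h.1)
  | _, x :: l, y :: l', h, h', h₁, h₂ => by
    simp only [List.cons_append, List.isChain_cons_cons] at h₁ h₂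
    obtain rfl := hr h₁.1 h₂.1
    rw [List.eq_of_isChain_of_rightUnique hr (List.not_mem_of_not_mem_cons h)
      (List.not_mem_of_not_mem_cons h') h₁.2 h₂.2]

/-- Two cyclic chains without repetition of the same functional relation are equal as soon as
they share an element. -/
theorem Chain.eq_of_rightUnique (hr : Relator.RightUnique r) (hs : s.Chain r) (ht : t.Chain r)
    (hsn : s.Nodup) (htn : t.Nodup) {a : α} (has : a ∈ s) (hat : a ∈ t) : s = t := by
  obtain ⟨l, rfl⟩ := exists_eq_cons_of_mem has
  obtain ⟨l', rfl⟩ := exists_eq_cons_of_mem hat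
  rw [Cycle.nodup_coe_iff, List.nodup_cons] at hsn htn
  rw [Cycle.chain_coe_cons] at hs ht
  rw [List.eq_of_isChain_of_rightUnique hr hsn.1 htn.1 hs ht]

end Cycle

/-! ### Stable matchings -/

namespace SMInstance

variable {M W : Type} {n : ℕ} {I : SMInstance M W n} {μ ν : M ≃ W}

theorem eq_of_manRank_eq {m : M} {w w' : W} (h : I.manRank m w = I.manRank m w') : w = w' :=
  (I.manRank m).injective h

theorem eq_of_womanRank_eq {w : W} {m m' : M} (h : I.womanRank w m = I.womanRank w m') : m = m' :=
  (I.womanRank w).injective h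

/-- The pointwise order of matchings from the point of view of the men. -/
def ManLE (I : SMInstance M W n) (μ ν : M ≃ W) : Prop :=
  ∀ m, I.manRank m (μ m) ≤ I.manRank m (ν m)

/-- The ranks of the partners of all men. -/
def ranks (I : SMInstance M W n) (μ : M ≃ W) : M → Fin n := fun m => I.manRank m (μ m)

theorem ranks_injective (I : SMInstance M W n) : Function.Injective I.ranks := fun _ _ h =>
  Equiv.ext fun m => eq_of_manRank_eq (congrFun h m)

theorem ManLE.antisymm (h : I.ManLE μ ν) (h' : I.ManLE ν μ) : μ = ν :=
  I.ranks_injective (le_antisymm (a := I.ranks μ) h h')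

/-- `w` is the first woman after the partner of `m` on the list of `m` who prefers `m` to her
partner. -/
def IsNext (I : SMInstance M W n) (μ : M ≃ W) (m : M) (w : W) : Prop :=
  I.ManPrefers m (μ m) w ∧ I.WomanPrefers w m (μ.symm w) ∧
    ∀ w', I.ManPrefers m (μ m) w' → I.ManPrefers m w' w → ¬ I.WomanPrefers w' m (μ.symm w')

theorem IsNext.unique {m : M} {w w' : W} (h : I.IsNext μ m w) (h' : I.IsNext μ m w') : w = w' := by
  rcases lt_trichotomy (I.manRank m w) (I.manRank m w') with hlt | heq | hlt
  · exact absurd h.2.1 (h'.2.2 w h.1 hlt)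
  · exact eq_of_manRank_eq heq
  · exact absurd h'.2.1 (h.2.2 w' h'.1 hlt)

theorem IsNext.ne {m : M} {w : W} (h : I.IsNext μ m w) : μ m ≠ w := fun e =>
  lt_irrefl _ (e ▸ h.1 : I.ManPrefers m w w)

/-- Men and women have opposed interests: a woman worse off in `ν` would block `ν` with her partner
in `μ`. -/
theorem womanRank_symm_le (hν : I.IsStable ν) (h : I.ManLE μ ν) (w : W) :
    I.womanRank w (ν.symm w) ≤ I.womanRank w (μ.symm w) := by
  by_contra! hlt
  refine hν ⟨μ.symm w, w, lt_of_le_of_ne ?_ ?_, hlt⟩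
  · simpa using h (μ.symm w)
  · intro e
    have := eq_of_manRank_eq e
    rw [← Equiv.symm_apply_eq] at this
    rw [this] at hlt
    exact lt_irrefl _ hlt

theorem manLE_of_next (h : ∀ m, ν m = μ m ∨ I.IsNext μ m (ν m)) : I.ManLE μ ν := fun m =>
  (h m).elim (fun e => by rw [e]) fun e => e.1.le

/-- If every man keeps his partner or moves on to the next woman, the matching stays stable. -/
theorem IsStable.of_next (hμ : I.IsStable μ) (h : ∀ m, ν m = μ m ∨ I.IsNext μ m (ν m)) :
    I.IsStable ν := by
  rintro ⟨m, w, hm, hw⟩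
  have hle : I.womanRank w (ν.symm w) ≤ I.womanRank w (μ.symm w) := by
    rcases h (ν.symm w) with e | e
    · rw [Equiv.apply_symm_apply, ← Equiv.symm_apply_eq] at e
      rw [e]
    · rw [Equiv.apply_symm_apply] at e
      exact e.2.1.le
  have hw' : I.WomanPrefers w m (μ.symm w) := lt_of_lt_of_le hw hle
  rcases lt_trichotomy (I.manRank m w) (I.manRank m (μ m)) with hlt | heq | hlt
  · exact hμ ⟨m, w, hlt, hw'⟩
  · obtain rfl := eq_of_manRank_eq heq
    rw [Equiv.symm_apply_apply] at hw'
    exact lt_irrefl _ hw'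
  · rcases h m with e | e
    · rw [e] at hm
      exact lt_asymm hlt hm
    · exact e.2.2 w hlt hm hw'

/-! ### Meets of stable matchings -/

theorem exists_equiv_of_injective [Finite M] (μ : M ≃ W) {f : M → W} (hf : Function.Injective f) :
    ∃ ν : M ≃ W, ∀ m, ν m = f m := by
  have : Function.Bijective (μ.symm ∘ f) :=
    Finite.injective_iff_bijective.1 (μ.symm.injective.comp hf)
  exact ⟨(Equiv.ofBijective _ this).trans μ, fun m => by simp⟩

/-- `κ` gives every man the better one of his partners in `μ` and `ν`. -/
def IsMeet (I : SMInstance M W n) (μ ν κ : M ≃ W) : Prop :=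
  I.ManLE κ μ ∧ I.ManLE κ ν ∧ (∀ m, κ m = μ m ∨ κ m = ν m)

theorem IsMeet.symm_eq {κ : M ≃ W} (h : I.IsMeet μ ν κ) (w : W) :
    κ.symm w = μ.symm w ∨ κ.symm w = ν.symm w := by
  refine (h.2.2 (κ.symm w)).imp ?_ ?_ <;>
    · intro e
      rw [Equiv.apply_symm_apply] at e
      exact (Equiv.eq_symm_apply _).2 e.symm

/-- Each woman's partner in the meet is her partner in `μ` or in `ν`, and no man is worse off than
in either, so a blocking pair of the meet already blocks one of the two. -/
theorem exists_isMeet [Finite M] (hμ : I.IsStable μ) (hν : I.IsStable ν) :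
    ∃ κ, I.IsMeet μ ν κ ∧ I.IsStable κ := by
  classical
  let f : M → W := fun m => if I.manRank m (μ m) ≤ I.manRank m (ν m) then μ m else ν m
  -- Two men cannot claim the same woman from different matchings: whichever of them she prefers
  -- would block the matching that pairs her with the other.
  have key : ∀ m m', I.manRank m (μ m) ≤ I.manRank m (ν m) →
      I.manRank m' (ν m') < I.manRank m' (μ m') → μ m ≠ ν m' := by
    intro m m' h h' e
    have hne : m ≠ m' := by
      rintro rfl
      rw [e] at h'
      exact lt_irrefl _ h'
    rcases lt_trichotomy (I.womanRank (μ m) m) (I.womanRank (μ m) m') with hlt | heq | hlt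
    · refine hν ⟨m, μ m, lt_of_le_of_ne h fun e' => hne ?_, ?_⟩
      · exact ν.injective ((eq_of_manRank_eq e').symm.trans e)
      · rw [e, Equiv.symm_apply_apply, ← e]; exact hlt
    · exact hne (eq_of_womanRank_eq heq)
    · refine hμ ⟨m', μ m, ?_, ?_⟩
      · rw [e]; exact h'
      · rw [Equiv.symm_apply_apply]; exact hlt
  have hf : Function.Injective f := by
    intro m m' e
    simp only [f] at e
    split_ifs at e with h h' h'
    · exact μ.injective e
    · exact absurd e (key m m' h (not_le.1 h'))
    · exact absurd e.symm (key m' m h' (not_le.1 h))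
    · exact ν.injective e
  obtain ⟨κ, hκ⟩ := exists_equiv_of_injective μ hf
  have hmeet : I.IsMeet μ ν κ := by
    refine ⟨fun m => ?_, fun m => ?_, fun m => ?_⟩ <;> rw [hκ] <;> simp only [f] <;> split_ifs with h
    · exact le_rfl
    · exact (not_le.1 h).le
    · exact h
    · exact le_rfl
    · exact Or.inl rfl
    · exact Or.inr rfl
  refine ⟨κ, hmeet, ?_⟩
  rintro ⟨m, w, hm, hw⟩
  rcases hmeet.symm_eq w with e | e <;> rw [e] at hw
  · exact hμ ⟨m, w, lt_of_lt_of_le hm (hmeet.1 m), hw⟩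
  · exact hν ⟨m, w, lt_of_lt_of_le hm (hmeet.2.1 m), hw⟩

/-- A minimal rank vector is least, since the meet with any other member lies in `S` and cannot be
strictly smaller. -/
theorem exists_least [Finite M] {S : Set (M ≃ W)} (hS : S.Nonempty)
    (hmeet : ∀ μ ∈ S, ∀ ν ∈ S, ∀ κ, I.IsMeet μ ν κ → I.IsStable κ → κ ∈ S)
    (hstable : ∀ μ ∈ S, I.IsStable μ) : ∃ μ ∈ S, ∀ ν ∈ S, I.ManLE μ ν := by
  obtain ⟨μ, hμ, hmin⟩ :=
    (InvImage.wf I.ranks (wellFounded_lt (α := M → Fin n))).has_min S hS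
  refine ⟨μ, hμ, fun ν hν => ?_⟩
  obtain ⟨κ, hκ, hκs⟩ := exists_isMeet (hstable μ hμ) (hstable ν hν)
  have : I.ranks κ = I.ranks μ := by
    by_contra hne
    exact hmin κ (hmeet μ hμ ν hν κ hκ hκs) (lt_of_le_of_ne (show I.ranks κ ≤ I.ranks μ from hκ.1) hne)
  rw [← I.ranks_injective this]
  exact hκ.2.1

theorem exists_isManOptimal [Finite M] (h : I.IsStable μ) : ∃ ν, I.IsManOptimal ν := by
  obtain ⟨ν, hν, hle⟩ := exists_least (I := I) (S := {ν | I.IsStable ν}) ⟨μ, h⟩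
    (fun _ _ _ _ _ _ hs => hs) (fun _ h => h)
  exact ⟨ν, hν, fun κ hκ => hle κ hκ⟩

theorem IsManOptimal.unique (h : I.IsManOptimal μ) (h' : I.IsManOptimal ν) : μ = ν :=
  ManLE.antisymm (fun m => h.2 ν h'.1 m) fun m => h'.2 μ h.1 m

/-! ### Exposed rotations -/

theorem IsExposed.chain_isNext {ρ : Cycle (M × W)} (h : I.IsExposed ρ μ) :
    ρ.Chain fun p q : M × W => p ∈ ρ ∧ q ∈ ρ ∧ μ p.1 = p.2 ∧ μ q.1 = q.2 ∧ I.IsNext μ p.1 q.2 := by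
  refine h.2.2.2.2.and_mem.imp ?_
  rintro p q ⟨hp, hq, h₁, h₂, h₃⟩
  have hp' := h.2.2.2.1 p hp
  have hq' := h.2.2.2.1 q hq
  refine ⟨hp, hq, hp', hq', by rwa [hp'], ?_, by rwa [hp']⟩
  rwa [(Equiv.symm_apply_eq _).2 hq'.symm]

theorem IsExposed.exists_mem {ρ : Cycle (M × W)} (h : I.IsExposed ρ μ) : ∃ p, p ∈ ρ := by
  obtain ⟨-, h, -⟩ := h
  induction ρ using Cycle.induction_on with
  | nil => exact absurd rfl h
  | cons a l _ => exact ⟨a, by simp [Cycle.mem_coe_iff]⟩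

/-- Distinct rotations exposed in the same matching are disjoint. -/
theorem IsExposed.eq_of_mem {ρ σ : Cycle (M × W)} (hρ : I.IsExposed ρ μ) (hσ : I.IsExposed σ μ)
    {p : M × W} (h : p ∈ ρ) (h' : p ∈ σ) : ρ = σ := by
  have hr : Relator.RightUnique
      fun p q : M × W => μ p.1 = p.2 ∧ μ q.1 = q.2 ∧ I.IsNext μ p.1 q.2 := by
    rintro p q q' ⟨-, hq, hn⟩ ⟨-, hq', hn'⟩
    have := hn.unique hn'
    exact Prod.ext (μ.injective (by rw [hq, hq', this])) this
  exact Cycle.Chain.eq_of_rightUnique hr (hρ.chain_isNext.imp fun _ _ h => h.2.2)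
    (hσ.chain_isNext.imp fun _ _ h => h.2.2) hρ.2.2.1 hσ.2.2.1 h h'

/-- The pairs of `ρ` belong to both matchings, hence to the meet. A skipped woman has her partner
from `μ` or `ν`, and in both cases she does not prefer the man who skips her. -/
theorem IsExposed.meet {ρ : Cycle (M × W)} {κ : M ≃ W} (hμ : I.IsExposed ρ μ)
    (hν : I.IsExposed ρ ν) (hκ : I.IsMeet μ ν κ) (hs : I.IsStable κ) : I.IsExposed ρ κ := by
  refine ⟨hs, hμ.2.1, hμ.2.2.1, fun p hp => ?_, ?_⟩
  · rcases hκ.2.2 p.1 with e | e <;> rw [e]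
    exacts [hμ.2.2.2.1 p hp, hν.2.2.2.1 p hp]
  · refine (hμ.2.2.2.2.and hν.2.2.2.2).imp ?_
    rintro p q ⟨⟨h₁, h₂, h₃⟩, -, -, h₃'⟩
    refine ⟨h₁, h₂, fun w hw hw' => ?_⟩
    rcases hκ.symm_eq w with e | e <;> rw [e]
    exacts [h₃ w hw hw', h₃' w hw hw']

end SMInstance

namespace SMInstance

variable {M W : Type} {n : ℕ} {I : SMInstance M W n} {μ ν : M ≃ W}

/-! ### Paths of eliminations -/

theorem exists_isNext {m : M} {w₀ : W} (h : I.ManPrefers m (μ m) w₀)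
    (h' : I.WomanPrefers w₀ m (μ.symm w₀)) :
    ∃ w, I.IsNext μ m w ∧ I.manRank m w ≤ I.manRank m w₀ := by
  obtain ⟨w, hw, hmin⟩ := (InvImage.wf (I.manRank m) (wellFounded_lt (α := Fin n))).has_min
    {w | I.ManPrefers m (μ m) w ∧ I.WomanPrefers w m (μ.symm w)} ⟨w₀, h, h'⟩
  exact ⟨w, ⟨hw.1, hw.2, fun w' h₁ h₂ h₃ => hmin w' ⟨h₁, h₃⟩ h₂⟩, not_lt.1 (hmin w₀ ⟨h, h'⟩)⟩

/-- Below a stable matching `ν` one can always eliminate a rotation and stay below `ν`. -/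
theorem exists_elimination_le [Finite M] (hμ : I.IsStable μ) (hν : I.IsStable ν)
    (hle : I.ManLE μ ν) (hne : μ ≠ ν) : ∃ ρ μ', I.IsExposed ρ μ ∧ IsElimination μ ρ μ' ∧
      I.IsStable μ' ∧ I.ManLE μ' ν ∧ I.ranks μ < I.ranks μ' := by
  classical
  obtain ⟨m₀, hm₀⟩ : ∃ m, μ m ≠ ν m := by
    by_contra! h
    exact hne (Equiv.ext h)
  -- The woman `ν m` is a candidate, so the next woman comes no later. Her current partner must move
  -- as well, or she and `m` would block `ν`.
  have hstep : ∀ m, μ m ≠ ν m → ∃ w, I.IsNext μ m w ∧ I.manRank m w ≤ I.manRank m (ν m) ∧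
      μ (μ.symm w) ≠ ν (μ.symm w) := by
    intro m hm
    have hw : I.WomanPrefers (ν m) m (μ.symm (ν m)) := by
      refine lt_of_le_of_ne ?_ fun e => hm ?_
      · simpa using womanRank_symm_le hν hle (ν m)
      · exact ((Equiv.eq_symm_apply _).1 (eq_of_womanRank_eq e))
    obtain ⟨w, hnext, hwle⟩ :=
      exists_isNext (lt_of_le_of_ne (hle m) fun e => hm (eq_of_manRank_eq e)) hw
    refine ⟨w, hnext, hwle, fun e => ?_⟩
    rw [Equiv.apply_symm_apply] at e
    have hsymm : ν.symm w = μ.symm w := (Equiv.symm_apply_eq _).2 e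
    refine hν ⟨m, w, lt_of_le_of_ne hwle fun e' => ?_, by rw [hsymm]; exact hnext.2.1⟩
    have h1 := eq_of_manRank_eq e'
    have h2 : m = μ.symm w := ν.injective (h1.symm.trans e)
    exact hnext.ne ((Equiv.eq_symm_apply _).1 h2)
  have : Nonempty W := ⟨μ m₀⟩
  choose! s hs using hstep
  let g : M → M := fun m => μ.symm (s m)
  have hμg : ∀ m, μ (g m) = s m := fun m => Equiv.apply_symm_apply _ _
  have hmoved : ∀ k m, μ m ≠ ν m → μ (g^[k] m) ≠ ν (g^[k] m) := by
    intro k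
    induction k with
    | zero => exact fun m h => h
    | succ k ih => exact fun m h => ih _ (hs m h).2.2
  -- By finiteness, passing from a man to the current partner of his next woman becomes periodic;
  -- the periodic orbit is the rotation.
  obtain ⟨x, hx, hxp⟩ : ∃ x, μ x ≠ ν x ∧ x ∈ Function.periodicPts g := by
    obtain ⟨i, j, hij, e⟩ := Finite.exists_ne_map_eq_of_infinite fun k : ℕ => g^[k] m₀
    wlog hlt : i < j generalizing i j
    · exact this j i hij.symm e.symm (lt_of_le_of_ne (not_lt.1 hlt) hij.symm)
    refine ⟨g^[i] m₀, hmoved i m₀ hm₀, Function.mem_periodicPts.2 ⟨j - i, Nat.sub_pos_of_lt hlt, ?_⟩⟩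
    change g^[j - i] (g^[i] m₀) = g^[i] m₀
    rw [← Function.iterate_add_apply, Nat.sub_add_cancel hlt.le]
    exact e.symm
  let O : Cycle M := Function.periodicOrbit g x
  have hOmem : ∀ m, m ∈ O ↔ ∃ k, g^[k] x = m := fun m => Function.mem_periodicOrbit_iff hxp
  have hOmoved : ∀ m ∈ O, μ m ≠ ν m := by
    intro m hm
    obtain ⟨k, rfl⟩ := (hOmem m).1 hm
    exact hmoved k x hx
  have hOg : ∀ m ∈ O, g m ∈ O := by
    intro m hm
    obtain ⟨k, rfl⟩ := (hOmem m).1 hm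
    exact (hOmem _).2 ⟨k + 1, Function.iterate_succ_apply' g k x⟩
  have hOper : ∀ m ∈ O, m ∈ Function.periodicPts g := by
    intro m hm
    obtain ⟨k, rfl⟩ := (hOmem m).1 hm
    exact (Function.bijOn_periodicPts g).mapsTo.iterate k hxp
  let π : M → W := fun m => if m ∈ O then s m else μ m
  have hπ : Function.Injective π := by
    have key : ∀ a b, a ∈ O → b ∉ O → s a ≠ μ b := by
      intro a b ha hb e
      rw [← hμg] at e
      exact hb (μ.injective e ▸ hOg a ha)
    intro a b e
    simp only [π] at e
    split_ifs at e with ha hb hb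
    · rw [← hμg, ← hμg] at e
      exact (Function.bijOn_periodicPts g).injOn (hOper a ha) (hOper b hb) (μ.injective e)
    · exact absurd e (key a b ha hb)
    · exact absurd e.symm (key b a hb ha)
    · exact μ.injective e
  obtain ⟨μ', hμ'⟩ := exists_equiv_of_injective μ hπ
  have hin : ∀ m ∈ O, μ' m = s m := fun m hm => by rw [hμ']; exact if_pos hm
  have hout : ∀ m, m ∉ O → μ' m = μ m := fun m hm => by rw [hμ']; exact if_neg hm
  have hnext : ∀ m, μ' m = μ m ∨ I.IsNext μ m (μ' m) := by
    intro m
    by_cases hm : m ∈ O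
    · rw [hin m hm]
      exact Or.inr (hs m (hOmoved m hm)).1
    · exact Or.inl (hout m hm)
  have hxO : x ∈ O := Function.self_mem_periodicOrbit hxp
  have hchain : O.Chain fun a b => a ∈ O ∧ b = g a :=
    (Function.periodicOrbit_chain' _ hxp).2 fun k =>
      ⟨(hOmem _).2 ⟨k, rfl⟩, Function.iterate_succ_apply' g k x⟩
  refine ⟨O.map fun m => (m, μ m), μ', ⟨hμ, ?_, ?_, ?_, ?_⟩, ⟨?_, ?_⟩, hμ.of_next hnext, ?_, ?_⟩
  · rw [Ne, Cycle.map_eq_nil]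
    intro e
    rw [e] at hxO
    exact Cycle.notMem_nil _ hxO
  · exact Function.nodup_periodicOrbit.map fun a b e => (Prod.mk.inj e).1
  · intro p hp
    obtain ⟨m, -, rfl⟩ := Cycle.mem_map.1 hp
    rfl
  · rw [Cycle.chain_map]
    refine hchain.imp ?_
    rintro a _ ⟨ha, rfl⟩
    have := (hs a (hOmoved a ha)).1
    simp only [hμg]
    exact this
  · rw [Cycle.chain_map]
    refine hchain.imp ?_
    rintro a _ ⟨ha, rfl⟩
    simp only [hμg]
    exact hin a ha
  · exact fun m hm => hout m fun hmO => hm (μ m) (Cycle.mem_map.2 ⟨m, hmO, rfl⟩)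
  · intro m
    by_cases hm : m ∈ O
    · rw [hin m hm]
      exact (hs m (hOmoved m hm)).2.1
    · rw [hout m hm]
      exact hle m
  · refine lt_of_le_of_ne (manLE_of_next hnext) fun e => ?_
    have := congrFun e x
    exact (hs x hx).1.ne ((eq_of_manRank_eq this).trans (hin x hxO))

theorem Reaches.exists_of_manLE [Finite M] (hν : I.IsStable ν) {S : Set (Cycle (M × W))}
    (h : I.Reaches μ S) (hμ : I.IsStable μ) (hle : I.ManLE μ ν) :
    ∃ T, S ⊆ T ∧ I.Reaches ν T := by
  induction hr : I.ranks μ using (wellFounded_gt (α := M → Fin n)).induction generalizing μ S with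
  | _ r ih =>
    by_cases hne : μ = ν
    · exact ⟨S, subset_rfl, hne ▸ h⟩
    · obtain ⟨ρ, μ', hρ, hel, hs, hle', hlt⟩ := exists_elimination_le hμ hν hle hne
      obtain ⟨T, hST, hT⟩ := ih _ (hr ▸ hlt) (h.eliminate _ _ _ _ hρ hel) hs hle' rfl
      exact ⟨T, (Set.subset_insert _ _).trans hST, hT⟩

/-- `μ` is the man-best stable matching in which `ρ` is exposed. -/
def IsLeastExposing (I : SMInstance M W n) (ρ : Cycle (M × W)) (μ : M ≃ W) : Prop :=
  I.IsExposed ρ μ ∧ ∀ ν, I.IsExposed ρ ν → I.ManLE μ ν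

theorem exists_isLeastExposing [Finite M] (ρ : I.Rotation) : ∃ μ, I.IsLeastExposing ρ.1 μ :=
  exists_least (S := {μ | I.IsExposed ρ.1 μ}) ρ.2
    (fun _ hμ _ hν _ hκ hs => hμ.meet hν hκ hs) fun _ h => h.1

theorem Reaches.exists_isExposed {S : Set (Cycle (M × W))} (h : I.Reaches μ S) :
    ∀ ρ ∈ S, ∃ ν, I.IsExposed ρ ν := by
  induction h with
  | manOptimal => exact fun _ h => absurd h (Set.notMem_empty _)
  | eliminate μ _ S ρ _ hρ _ ih =>
    rintro σ (rfl | hσ)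
    exacts [⟨_, hρ⟩, ih σ hσ]

/-- Every matching exposing `ρ` is man-worse than `μ`, so the eliminations leading to `μ` can be
continued to it. -/
theorem IsLeastExposing.precedes [Finite M] {ρ σ : I.Rotation} (h : I.IsLeastExposing ρ.1 μ)
    {S : Set (Cycle (M × W))} (hS : I.Reaches μ S) (hσ : σ.1 ∈ S) : I.Precedes σ ρ := by
  intro ν hν
  obtain ⟨T, hST, hT⟩ := hS.exists_of_manLE hν.1 h.1.1 (h.2 ν hν)
  exact ⟨T, hT, hST hσ⟩

theorem exists_reaches [Finite M] (h : I.IsStable μ) : ∃ S, I.Reaches μ S := by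
  obtain ⟨κ, hκ⟩ := exists_isManOptimal h
  obtain ⟨T, -, hT⟩ := (Reaches.manOptimal κ hκ).exists_of_manLE h hκ.1 (hκ.2 μ h)
  exact ⟨T, hT⟩

/-- A rotation without predecessors is exposed in the man-optimal stable matching. -/
theorem isExposed_of_forall_not_precedes [Finite M] {ρ : I.Rotation}
    (h : ∀ σ, ¬ I.Precedes σ ρ) (hμ : I.IsManOptimal μ) : I.IsExposed ρ.1 μ := by
  obtain ⟨ν, hν⟩ := exists_isLeastExposing ρ
  obtain ⟨S, hS⟩ := exists_reaches hν.1.1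
  cases hS with
  | manOptimal _ hopt => exact hμ.unique hopt ▸ hν.1
  | eliminate μ₁ _ S σ hS hσ hel =>
    exact absurd (hν.precedes (σ := ⟨σ, μ₁, hσ⟩) (hS.eliminate _ _ _ _ hσ hel)
      (Set.mem_insert _ _)) (h _)

/-- If a matching is reached by eliminating only rotations exposed in `μ`, then the men of these
rotations have moved to their next woman and all other men have kept their partner. -/
theorem Reaches.isNext_of_isExposed {κ : M ≃ W} (hμ : I.IsManOptimal μ) {S : Set (Cycle (M × W))}
    (h : I.Reaches κ S) (hS : ∀ ρ ∈ S, I.IsExposed ρ μ) :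
    (∀ ρ ∈ S, ∀ p ∈ ρ, I.IsNext μ p.1 (κ p.1)) ∧
      ∀ m, (∀ ρ ∈ S, ∀ w, (m, w) ∉ ρ) → κ m = μ m := by
  induction h with
  | manOptimal κ hκ =>
    exact ⟨fun _ h => absurd h (Set.notMem_empty _), fun m _ => by rw [hκ.unique hμ]⟩
  | eliminate κ κ' S ρ _ _ hel ih =>
    obtain ⟨ih₁, ih₂⟩ := ih fun σ hσ => hS σ (Set.mem_insert_of_mem _ hσ)
    have hρ : ∀ p ∈ ρ, I.IsNext μ p.1 (κ' p.1) := by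
      intro p hp
      obtain ⟨q, -, ⟨-, -, -, -, hn⟩, hq⟩ :=
        ((hS ρ (Set.mem_insert _ _)).chain_isNext.and hel.1).exists_next hp
      rwa [hq]
    refine ⟨?_, fun m hm => ?_⟩
    · rintro σ (rfl | hσ) p hp
      · exact hρ p hp
      · by_cases hpρ : ∃ w, (p.1, w) ∈ ρ
        · obtain ⟨w, hw⟩ := hpρ
          exact (hρ (p.1, w) hw :)
        · push Not at hpρ
          rw [hel.2 p.1 hpρ]
          exact ih₁ σ hσ p hp
    · rw [hel.2 m (hm ρ (Set.mem_insert _ _))]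
      exact ih₂ m fun σ hσ => hm σ (Set.mem_insert_of_mem _ hσ)

end SMInstance

namespace SMInstance

variable {M W : Type} {n : ℕ} {I : SMInstance M W n} {μ κ : M ≃ W}

/-! ### Contact between a rotation and an immediate predecessor -/

/-- If `κ` arises from `μ` by moving some men, among them those of the rotation `ρ`, to their next
women, and if `σ` is not exposed before `κ`, then some step of `σ` passes a woman of `ρ`. -/
theorem exists_woman_between [Finite M] {ρ σ : Cycle (M × W)} (hρ : I.IsExposed ρ μ)
    (hnext : ∀ m, κ m = μ m ∨ I.IsNext μ m (κ m)) (hρκ : ∀ p ∈ ρ, I.IsNext μ p.1 (κ p.1))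
    (hσ : I.IsLeastExposing σ κ) :
    ∃ p ∈ σ, ∃ q ∈ σ, ∃ a ∈ ρ, κ p.1 = p.2 ∧ I.IsNext κ p.1 q.2 ∧
      I.manRank p.1 p.2 ≤ I.manRank p.1 a.2 ∧ I.manRank p.1 a.2 < I.manRank p.1 q.2 := by
  classical
  by_contra! hno
  have hsucc : ∀ p ∈ ρ, ∃ q ∈ ρ, κ p.1 = q.2 := by
    intro p hp
    obtain ⟨q, hq, -, -, -, -, hn⟩ := hρ.chain_isNext.exists_next hp
    exact ⟨q, hq, (hρκ p hp).unique hn⟩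
  have hpred : ∀ p ∈ ρ, ∃ q ∈ ρ, κ q.1 = p.2 := by
    intro p hp
    obtain ⟨q, hq, -, -, -, -, hn⟩ := hρ.chain_isNext.exists_prev hp
    exact ⟨q, hq, (hρκ q hq).unique hn⟩
  let O : Set M := {m | ∃ p ∈ ρ, p.1 = m}
  -- The rotation `ρ` is undone in `κ`. The result is a matching because `κ` permutes the women of
  -- `ρ` among its men.
  let f : M → W := fun m => if m ∈ O then μ m else κ m
  have hf : Function.Injective f := by
    have key : ∀ a b, a ∈ O → b ∉ O → μ a ≠ κ b := by
      rintro _ b ⟨p, hp, rfl⟩ hb e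
      obtain ⟨q, hq, hqp⟩ := hpred p hp
      rw [hρ.2.2.2.1 p hp, ← hqp] at e
      exact hb ⟨q, hq, κ.injective e⟩
    intro a b e
    simp only [f] at e
    split_ifs at e with ha hb hb
    · exact μ.injective e
    · exact absurd e (key a b ha hb)
    · exact absurd e.symm (key b a hb ha)
    · exact κ.injective e
  obtain ⟨ν, hν⟩ := exists_equiv_of_injective μ hf
  have hin : ∀ m ∈ O, ν m = μ m := fun m hm => by rw [hν]; exact if_pos hm
  have hout : ∀ m, m ∉ O → ν m = κ m := fun m hm => by rw [hν]; exact if_neg hm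
  have hνs : I.IsStable ν := by
    refine hρ.1.of_next fun m => ?_
    by_cases hm : m ∈ O
    · exact Or.inl (hin m hm)
    · rw [hout m hm]
      exact hnext m
  obtain ⟨a, ha⟩ := hρ.exists_mem
  suffices hexp : I.IsExposed σ ν by
    have := hσ.2 ν hexp a.1
    rw [hin a.1 ⟨a, ha, rfl⟩] at this
    exact not_le.2 (hρκ a ha).1 this
  -- If no step of `σ` starts at or skips a woman of `ρ`, its men are outside `ρ` and the women it
  -- skips have the same partners in `ν` and `κ`.
  refine ⟨hνs, hσ.1.2.1, hσ.1.2.2.1, fun p hp => ?_, ?_⟩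
  · by_cases hm : p.1 ∈ O
    · exfalso
      obtain ⟨b, hb, hbp⟩ := hm
      obtain ⟨c, hc, hbc⟩ := hsucc b hb
      obtain ⟨q, hq, -, -, hp', -, hn⟩ := hσ.1.chain_isNext.exists_next hp
      rw [hbp, hp'] at hbc
      refine not_lt.2 (hno p hp q hq c hc hp' hn (hbc ▸ le_rfl)) ?_
      rw [← hbc, ← hp']
      exact hn.1
    · rw [hout _ hm]
      exact hσ.1.2.2.2.1 p hp
  · refine (hσ.1.2.2.2.2.and hσ.1.chain_isNext).imp ?_
    rintro p q ⟨⟨h₁, h₂, h₃⟩, hp, hq, hp', -, hn⟩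
    refine ⟨h₁, h₂, fun w hw hw' => ?_⟩
    have : ν.symm w = κ.symm w := by
      rw [Equiv.symm_apply_eq]
      by_cases hm : κ.symm w ∈ O
      · exfalso
        obtain ⟨b, hb, hbw⟩ := hm
        obtain ⟨c, hc, hbc⟩ := hsucc b hb
        rw [hbw, Equiv.apply_symm_apply] at hbc
        subst hbc
        exact not_lt.2 (hno p hp q hq c hc hp' hn hw.le) hw'
      · rw [hout _ hm, Equiv.apply_symm_apply]
    rw [this]
    exact h₃ w hw hw'

end SMInstance

/-! ### The complete bipartite posets -/

/-- The poset of `N` minimal elements below `N` maximal elements. -/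
def BipartitePoset (N : ℕ) : Type := Fin N ⊕ Fin N

instance (N : ℕ) : Finite (BipartitePoset N) := inferInstanceAs (Finite (Fin N ⊕ Fin N))

instance (N : ℕ) : PartialOrder (BipartitePoset N) where
  le x y := x = y ∨ (Sum.isLeft x ∧ Sum.isRight y)
  le_refl _ := Or.inl rfl
  le_trans := by
    rintro x y z (rfl | h) (rfl | h')
    exacts [Or.inl rfl, Or.inr h', Or.inr h, Or.inr ⟨h.1, h'.2⟩]
  le_antisymm := by
    rintro x y (rfl | h) (h' | h')
    exacts [rfl, rfl, h'.symm, by rcases x with x | x <;> simp_all]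

theorem BipartitePoset.lt_iff {N : ℕ} (x y : BipartitePoset N) :
    x < y ↔ Sum.isLeft x ∧ Sum.isRight y := by
  change ((x = y ∨ _) ∧ ¬ (y = x ∨ _)) ↔ _
  rcases x with x | x <;> rcases y with y | y <;> simp
  all_goals exact fun h => h.symm

namespace SMInstance

variable {M W : Type} {n : ℕ} {I : SMInstance M W n} {μ κ : M ≃ W}

/-- In an instance that realizes a complete bipartite poset the minimal rotations are exposed in a
common matching, the maximal ones as well, and every maximal rotation has a step that passes a
woman of any given minimal rotation. -/
theorem Realizes.exists_rotations [Finite M] {N : ℕ} (hN : 0 < N)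
    (h : I.Realizes (BipartitePoset N)) :
    ∃ (μ κ : M ≃ W) (ρ σ : Fin N → Cycle (M × W)), Function.Injective ρ ∧ Function.Injective σ ∧
      (∀ i, I.IsExposed (ρ i) μ) ∧ (∀ j, I.IsExposed (σ j) κ) ∧
      ∀ i j, ∃ p ∈ σ j, ∃ q ∈ σ j, ∃ a ∈ ρ i, κ p.1 = p.2 ∧ I.IsNext κ p.1 q.2 ∧
        I.manRank p.1 p.2 ≤ I.manRank p.1 a.2 ∧ I.manRank p.1 a.2 < I.manRank p.1 q.2 := by
  obtain ⟨f, hf⟩ := h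
  let A : Fin N → I.Rotation := fun i => f (Sum.inl i : Fin N ⊕ Fin N)
  let B : Fin N → I.Rotation := fun j => f (Sum.inr j : Fin N ⊕ Fin N)
  have hAB : ∀ i j, I.Precedes (A i) (B j) := fun i j =>
    (hf _ _).1 ((BipartitePoset.lt_iff _ _).2 ⟨rfl, rfl⟩)
  have hprec : ∀ τ τ' : I.Rotation, I.Precedes τ τ' → (∃ i, τ = A i) ∧ ∀ i, τ' ≠ A i := by
    intro τ τ' hτ
    obtain ⟨x, rfl⟩ := f.surjective τ
    obtain ⟨y, rfl⟩ := f.surjective τ'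
    obtain ⟨hx, hy⟩ := (BipartitePoset.lt_iff _ _).1 ((hf x y).2 hτ)
    refine ⟨?_, ?_⟩
    · rcases x with x | x
      exacts [⟨x, rfl⟩, absurd hx (by simp)]
    · rintro i e
      rw [f.injective e] at hy
      simp at hy
  obtain ⟨μ₁, hμ₁⟩ := (A ⟨0, hN⟩).2
  obtain ⟨μ, hμ⟩ := exists_isManOptimal hμ₁.1
  have hA : ∀ i, I.IsExposed (A i).1 μ := fun i =>
    isExposed_of_forall_not_precedes (fun τ hτ => (hprec _ _ hτ).2 i rfl) hμ
  have hreach : ∀ j κ, I.IsLeastExposing (B j).1 κ → ∀ S, I.Reaches κ S →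
      ∀ τ ∈ S, ∃ i, τ = (A i).1 := by
    intro j κ hκ S hS τ hτ
    obtain ⟨i, hi⟩ := (hprec _ _ (hκ.precedes (σ := ⟨τ, hS.exists_isExposed τ hτ⟩) hS hτ)).1
    exact ⟨i, congrArg Subtype.val hi⟩
  have hreach' : ∀ j κ, I.IsLeastExposing (B j).1 κ → ∀ S, I.Reaches κ S →
      ∀ τ ∈ S, I.IsExposed τ μ := by
    intro j κ hκ S hS τ hτ
    obtain ⟨i, rfl⟩ := hreach j κ hκ S hS τ hτ
    exact hA i
  -- The rotations eliminated before `B j` are exactly the `A i`, so this description does not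
  -- depend on `j` and determines the matching.
  have hmove : ∀ j κ, I.IsLeastExposing (B j).1 κ →
      (∀ i, ∀ p ∈ (A i).1, I.IsNext μ p.1 (κ p.1)) ∧
        ∀ m, (∀ i w, (m, w) ∉ (A i).1) → κ m = μ m := by
    intro j κ hκ
    refine ⟨fun i p hp => ?_, fun m hm => ?_⟩
    · obtain ⟨S, hS, hAS⟩ := hAB i j κ hκ.1
      exact (hS.isNext_of_isExposed hμ (hreach' j κ hκ S hS)).1 _ hAS p hp
    · obtain ⟨S, hS⟩ := exists_reaches hκ.1.1
      refine (hS.isNext_of_isExposed hμ (hreach' j κ hκ S hS)).2 m fun τ hτ w => ?_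
      obtain ⟨i, rfl⟩ := hreach j κ hκ S hS τ hτ
      exact hm i w
  obtain ⟨κ, hκ⟩ := exists_isLeastExposing (B ⟨0, hN⟩)
  have hB : ∀ j, I.IsLeastExposing (B j).1 κ := by
    intro j
    obtain ⟨κ', hκ'⟩ := exists_isLeastExposing (B j)
    suffices κ' = κ from this ▸ hκ'
    ext m
    by_cases hm : ∀ i w, (m, w) ∉ (A i).1
    · rw [(hmove _ _ hκ).2 m hm, (hmove _ _ hκ').2 m hm]
    · push Not at hm
      obtain ⟨i, w, hw⟩ := hm
      exact ((hmove _ _ hκ').1 i _ hw).unique ((hmove _ _ hκ).1 i _ hw)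
  refine ⟨μ, κ, fun i => (A i).1, fun j => (B j).1, fun i j e => ?_, fun i j e => ?_, hA,
    fun j => (hB j).1, fun i j => exists_woman_between (hA i) (fun m => ?_) ((hmove _ _ hκ).1 i)
    (hB j)⟩
  · exact Sum.inl_injective (f.injective (Subtype.ext e))
  · exact Sum.inr_injective (f.injective (Subtype.ext e))
  · by_cases hm : ∀ i w, (m, w) ∉ (A i).1
    · exact Or.inl ((hmove _ _ hκ).2 m hm)
    · push Not at hm
      obtain ⟨i, w, hw⟩ := hm
      exact Or.inr ((hmove _ _ hκ).1 i _ hw)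

end SMInstance

/-! ### Families of sparse intervals -/

/-- If all elements of `X` are at most `R`, and the disjoint sets `Y j` have no gaps longer than
`D`, reach up to `R` and come `D`-close to `X`, then there are at most `D + 1` of them. -/
theorem card_le_of_forall_close {N D R : ℕ} {X : Set ℕ} {Y : Fin N → Set ℕ}
    (hX : ∀ x ∈ X, x ≤ R) (hgap : ∀ j, ∀ a ∈ Y j, ∀ b ∈ Y j, a < R → R ≤ b →
      ∃ y ∈ Y j, R ≤ y ∧ y ≤ R + D)
    (hY : ∀ j, ∃ y ∈ Y j, R ≤ y) (hclose : ∀ j, ∃ x ∈ X, ∃ y ∈ Y j, y ≤ x + D)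
    (hdisj : ∀ i j, ∀ y, y ∈ Y i → y ∈ Y j → i = j) : N ≤ D + 1 := by
  have : ∀ j, ∃ y ∈ Y j, R ≤ y ∧ y ≤ R + D := by
    intro j
    obtain ⟨x, hx, y, hy, hxy⟩ := hclose j
    obtain ⟨b, hb, hRb⟩ := hY j
    have hxR := hX x hx
    by_cases hyR : y < R
    · exact hgap j y hy b hb hyR hRb
    · exact ⟨y, hy, not_lt.1 hyR, by omega⟩
  choose y hy h₁ h₂ using this
  have hinj : Function.Injective y := fun i j e => hdisj i j (y i) (hy i) (e ▸ hy j)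
  have := Finset.card_le_card_of_injOn (s := Finset.univ) (t := Finset.Icc R (R + D)) y
    (fun j _ => by simp [h₁, h₂]) hinj.injOn
  simp at this
  omega

/-- Two families of nonempty bounded sets of natural numbers without gaps longer than `D`, each
disjoint, such that every two sets of different families are `D`-close, have at most `D + 1`
members. -/
theorem card_le_of_pairwise_close {N D n : ℕ} {X Y : Fin N → Set ℕ} (hN : 0 < N)
    (hXn : ∀ i, (X i).Nonempty) (hYn : ∀ i, (Y i).Nonempty) (hXb : ∀ i, ∀ x ∈ X i, x ≤ n)
    (hXgap : ∀ R j, ∀ a ∈ X j, ∀ b ∈ X j, a < R → R ≤ b → ∃ y ∈ X j, R ≤ y ∧ y ≤ R + D)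
    (hYgap : ∀ R j, ∀ a ∈ Y j, ∀ b ∈ Y j, a < R → R ≤ b → ∃ y ∈ Y j, R ≤ y ∧ y ≤ R + D)
    (hclose : ∀ i j, ∃ x ∈ X i, ∃ y ∈ Y j, y ≤ x + D ∧ x ≤ y + D)
    (hXdisj : ∀ i j, ∀ y, y ∈ X i → y ∈ X j → i = j)
    (hYdisj : ∀ i j, ∀ y, y ∈ Y i → y ∈ Y j → i = j) : N ≤ D + 1 := by
  classical
  -- The least such `R` is the leftmost right end of all the sets; by minimality every set has an
  -- element at or beyond it.
  have hex : ∃ R, (∃ i, ∀ x ∈ X i, x ≤ R) ∨ ∃ j, ∀ y ∈ Y j, y ≤ R := ⟨n, Or.inl ⟨⟨0, hN⟩, hXb _⟩⟩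
  have hmin : ∀ Z : Set ℕ, Z.Nonempty → (∀ R, (∀ z ∈ Z, z ≤ R) → Nat.find hex ≤ R) →
      ∃ z ∈ Z, Nat.find hex ≤ z := by
    intro Z ⟨z, hz⟩ hR
    by_contra! hlt
    have := hR (Nat.find hex - 1) fun z hz => Nat.le_sub_one_of_lt (hlt z hz)
    have := hlt z hz
    omega
  have hX : ∀ i, ∃ x ∈ X i, Nat.find hex ≤ x := fun i =>
    hmin _ (hXn i) fun R hR => Nat.find_min' hex (Or.inl ⟨i, hR⟩)
  have hY : ∀ j, ∃ y ∈ Y j, Nat.find hex ≤ y := fun j =>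
    hmin _ (hYn j) fun R hR => Nat.find_min' hex (Or.inr ⟨j, hR⟩)
  rcases Nat.find_spec hex with ⟨i, hi⟩ | ⟨j, hj⟩
  · refine card_le_of_forall_close hi (hYgap _) hY (fun j => ?_) hYdisj
    obtain ⟨x, hx, y, hy, h, -⟩ := hclose i j
    exact ⟨x, hx, y, hy, h⟩
  · refine card_le_of_forall_close hj (hXgap _) hX (fun i => ?_) hXdisj
    obtain ⟨x, hx, y, hy, -, h⟩ := hclose i j
    exact ⟨y, hy, x, hx, h⟩

/-- Pigeonhole for initial segments of two lists. -/
theorem Nat.le_of_injective_of_lt {α β : Type} {n a b : ℕ} (e : α ≃ Fin n) (e' : β ≃ Fin n)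
    {f : α → β} (hf : Function.Injective f) (ha : a ≤ n)
    (h : ∀ x, (e x : ℕ) < a → (e' (f x) : ℕ) < b) : a ≤ b := by
  let g : Fin a → Fin b := fun i =>
    ⟨e' (f (e.symm ⟨i, i.2.trans_le ha⟩)), h _ (by simp)⟩
  have hg : Function.Injective g := by
    intro i j hij
    have h1 : e' (f (e.symm ⟨i, i.2.trans_le ha⟩)) = e' (f (e.symm ⟨j, j.2.trans_le ha⟩)) :=
      Fin.ext (Fin.mk.inj_iff.1 hij)
    have h2 := e.symm.injective (hf (e'.injective h1))
    exact Fin.ext (Fin.mk.inj_iff.1 h2)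
  simpa using Fintype.card_le_of_injective g hg

namespace SMInstance

variable {M W : Type} {n : ℕ} {I : SMInstance M W n} {μ : M ≃ W}

/-! ### Instances of bounded range -/

theorem manRank_le_add_range [Finite M] [Finite W] (m m' : M) (w : W) :
    (I.manRank m w : ℕ) ≤ I.manRank m' w + I.range := by
  have h₁ : (I.manRank m w : ℕ) ≤ I.womanMaxRank w :=
    le_ciSup (f := fun m => (I.manRank m w : ℕ)) (Set.finite_range _).bddAbove m
  have h₂ : I.womanMinRank w ≤ I.manRank m' w :=
    ciInf_le (f := fun m => (I.manRank m w : ℕ)) (OrderBot.bddBelow _) m'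
  have h₃ : I.womanMaxRank w - I.womanMinRank w ≤ ⨆ w, (I.womanMaxRank w - I.womanMinRank w) :=
    le_ciSup (f := fun w => I.womanMaxRank w - I.womanMinRank w) (Set.finite_range _).bddAbove w
  have h₄ := le_max_left (⨆ w, (I.womanMaxRank w - I.womanMinRank w))
    (⨆ m, (I.manMaxRank m - I.manMinRank m))
  unfold range
  omega

theorem womanRank_le_add_range [Finite M] [Finite W] (w w' : W) (m : M) :
    (I.womanRank w m : ℕ) ≤ I.womanRank w' m + I.range := by
  have h₁ : (I.womanRank w m : ℕ) ≤ I.manMaxRank m :=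
    le_ciSup (f := fun w => (I.womanRank w m : ℕ)) (Set.finite_range _).bddAbove w
  have h₂ : I.manMinRank m ≤ I.womanRank w' m :=
    ciInf_le (f := fun w => (I.womanRank w m : ℕ)) (OrderBot.bddBelow _) w'
  have h₃ : I.manMaxRank m - I.manMinRank m ≤ ⨆ m, (I.manMaxRank m - I.manMinRank m) :=
    le_ciSup (f := fun m => I.manMaxRank m - I.manMinRank m) (Set.finite_range _).bddAbove m
  have h₄ := le_max_right (⨆ w, (I.womanMaxRank w - I.womanMinRank w))
    (⨆ m, (I.manMaxRank m - I.manMinRank m))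
  unfold range
  omega

/-- If every agent whom `a` prefers to `b` has a partner at least as good as `a`, then the position
of `b` exceeds that of `a` only by a multiple of the range. -/
theorem position_le_of_forall_le {A B : Type} {c : ℕ} (R : A → (B ≃ Fin n)) (R' : B → (A ≃ Fin n))
    (hR : ∀ a a' b, (R a b : ℕ) ≤ R a' b + c) (hR' : ∀ b b' a, (R' b a : ℕ) ≤ R' b' a + c)
    (a₀ : A) (b₀ : B) (π : B ≃ A) {a : A} {b : B}
    (h : ∀ b', R a b' < R a b → R' b' (π b') ≤ R' b' a) :
    (R a₀ b : ℕ) ≤ R' b₀ a + (4 * c + 1) := by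
  have hn := (R a₀ b).2
  -- Each `b'` more than `2 * c` places before `b` on the list of `a₀` is preferred to `b` by `a`,
  -- after two changes of list. Two more changes put `π b'` at most `2 * c` places after `a` on the
  -- list of `b₀`.
  have := Nat.le_of_injective_of_lt (R a₀) (R' b₀) (f := π) π.injective
    (a := R a₀ b - 2 * c) (b := R' b₀ a + 2 * c + 1) (by omega) fun b' hb' => by
      have h₁ := hR a a₀ b'
      have h₂ := hR a₀ a b
      have h₃ : (R' b' (π b') : ℕ) ≤ R' b' a := h b' (Fin.lt_def.2 (by omega))
      have h₄ := hR' b' b₀ a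
      have h₅ := hR' b₀ b' (π b')
      omega
  omega

/-- The next woman of a man is close to his partner. -/
theorem IsNext.position_le [Finite M] [Finite W] (hμ : I.IsStable μ) {c : ℕ} (hc : I.range ≤ c)
    (m₀ : M) {m : M} {w : W} (h : I.IsNext μ m w) :
    (I.manRank m₀ w : ℕ) ≤ I.manRank m₀ (μ m) + (8 * c + 2) := by
  have hR : ∀ a a' b, (I.manRank a b : ℕ) ≤ I.manRank a' b + c := fun a a' b =>
    (manRank_le_add_range a a' b).trans (by omega)
  have hR' : ∀ b b' a, (I.womanRank b a : ℕ) ≤ I.womanRank b' a + c := fun b b' a =>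
    (womanRank_le_add_range b b' a).trans (by omega)
  -- The count is applied twice, comparing `w` with `m` and then `m` with `μ m`, which gives twice
  -- `4 * c + 1`.
  have h₁ := position_le_of_forall_le I.manRank I.womanRank hR hR' m₀ w μ.symm (a := m) (b := w) (by
    intro w' hw'
    by_contra! hlt
    rcases lt_trichotomy (I.manRank m w') (I.manRank m (μ m)) with h' | h' | h'
    · exact hμ ⟨m, w', h', hlt⟩
    · obtain rfl := eq_of_manRank_eq h'
      simp at hlt
    · exact h.2.2 w' h' hw' hlt)
  have h₂ := position_le_of_forall_le I.womanRank I.manRank hR' hR w m₀ μ (a := μ m) (b := m) (by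
    intro m' hm'
    by_contra! hlt
    exact hμ ⟨m', μ m, hlt, by rwa [WomanPrefers, Equiv.symm_apply_apply]⟩)
  omega

/-- The women of a rotation leave no long gaps in the list of any man. -/
theorem IsExposed.exists_position [Finite M] [Finite W] {ρ : Cycle (M × W)} (hρ : I.IsExposed ρ μ)
    {c : ℕ} (hc : I.range ≤ c) (m₀ : M) {p q : M × W} (hp : p ∈ ρ) (hq : q ∈ ρ) {R : ℕ}
    (hpR : (I.manRank m₀ p.2 : ℕ) < R) (hqR : R ≤ I.manRank m₀ q.2) :
    ∃ a ∈ ρ, R ≤ I.manRank m₀ a.2 ∧ I.manRank m₀ a.2 ≤ R + (10 * c + 2) := by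
  by_contra! hno
  refine not_le.2 (hρ.chain_isNext.forall_of_imp
    (Q := fun a => (I.manRank m₀ a.2 : ℕ) < R) ?_ hp hq hpR) hqR
  rintro a b ⟨-, hb, ha, -, hab⟩ hlt
  by_contra! hle
  have h₁ := hab.position_le hρ.1 hc m₀
  have h₂ := hno b hb hle
  rw [ha] at h₁
  omega

theorem Realizes.card_le [Finite M] [Finite W] {N c : ℕ} (hN : 0 < N)
    (h : I.Realizes (BipartitePoset N)) (hc : I.range ≤ c) : N ≤ 10 * c + 2 + 1 := by
  obtain ⟨μ, κ, ρ, σ, hρi, hσi, hρ, hσ, hbetween⟩ := h.exists_rotations hN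
  have hR : ∀ a a' b, (I.manRank a b : ℕ) ≤ I.manRank a' b + c := fun a a' b =>
    (manRank_le_add_range a a' b).trans (by omega)
  obtain ⟨⟨m₀, -⟩, -⟩ := (hρ ⟨0, hN⟩).exists_mem
  have hdisj : ∀ {μ : M ≃ W} {τ : Fin N → Cycle (M × W)}, Function.Injective τ →
      (∀ i, I.IsExposed (τ i) μ) → ∀ i j x, (∃ p ∈ τ i, (I.manRank m₀ p.2 : ℕ) = x) →
      (∃ p ∈ τ j, (I.manRank m₀ p.2 : ℕ) = x) → i = j := by
    rintro μ τ hinj hτ i j _ ⟨p, hp, rfl⟩ ⟨q, hq, e⟩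
    have e' : q.2 = p.2 := eq_of_manRank_eq (Fin.ext e)
    have hqp : q = p := by
      refine Prod.ext (μ.injective ?_) e'
      rw [(hτ i).2.2.2.1 p hp, (hτ j).2.2.2.1 q hq, e']
    exact hinj ((hτ i).eq_of_mem (hτ j) hp (hqp ▸ hq))
  -- A step costs `8 * c + 2`; the further `2 * c` pays for translating the contact from the list of
  -- `p.1` to that of `m₀`.
  refine card_le_of_pairwise_close (n := n) (D := 10 * c + 2)
    (X := fun i => {x | ∃ p ∈ ρ i, (I.manRank m₀ p.2 : ℕ) = x})
    (Y := fun j => {x | ∃ p ∈ σ j, (I.manRank m₀ p.2 : ℕ) = x}) hN ?_ ?_ ?_ ?_ ?_ ?_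
    (hdisj hρi hρ) (hdisj hσi hσ)
  · intro i
    obtain ⟨p, hp⟩ := (hρ i).exists_mem
    exact ⟨_, p, hp, rfl⟩
  · intro i
    obtain ⟨p, hp⟩ := (hσ i).exists_mem
    exact ⟨_, p, hp, rfl⟩
  · rintro i _ ⟨p, -, rfl⟩
    exact (I.manRank m₀ p.2).2.le
  · rintro R j _ ⟨p, hp, rfl⟩ _ ⟨q, hq, rfl⟩ hpR hqR
    obtain ⟨a, ha, h⟩ := (hρ j).exists_position hc m₀ hp hq hpR hqR
    exact ⟨_, ⟨a, ha, rfl⟩, h⟩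
  · rintro R j _ ⟨p, hp, rfl⟩ _ ⟨q, hq, rfl⟩ hpR hqR
    obtain ⟨a, ha, h⟩ := (hσ j).exists_position hc m₀ hp hq hpR hqR
    exact ⟨_, ⟨a, ha, rfl⟩, h⟩
  · intro i j
    obtain ⟨p, hp, q, hq, a, ha, hp', hn, h₁, h₂⟩ := hbetween i j
    refine ⟨_, ⟨a, ha, rfl⟩, _, ⟨p, hp, rfl⟩, ?_⟩
    have h₃ := hn.position_le (hσ j).1 hc m₀
    rw [hp'] at h₃
    rw [Fin.le_def] at h₁
    rw [Fin.lt_def] at h₂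
    have h₄ := hR m₀ p.1 a.2
    have h₅ := hR p.1 m₀ a.2
    have h₆ := hR m₀ p.1 p.2
    have h₇ := hR p.1 m₀ q.2
    omega

end SMInstance

theorem mainTheorem8 :
    ¬ ∃ c : ℕ, ∀ (P : Type) [Finite P] [PartialOrder P],
      ∃ (n : ℕ) (_ : 0 < n) (I : SMInstance (Fin n) (Fin n) n), I.range ≤ c ∧ I.Realizes P := by
  rintro ⟨c, h⟩
  -- One more than the bound of `Realizes.card_le`.
  obtain ⟨n, -, I, hc, hI⟩ := h (BipartitePoset (10 * c + 2 + 2))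
  have := hI.card_le (Nat.succ_pos _) hc
  omega
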